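/- Let outcomes be vectors in $\mathbb{R}^m$, let $\mathcal P$ be a Borel probability distribution on $\mathbb{R}^m$, and let $\mathcal F=\{R_\theta:\theta\in\Theta\}$ be a family of measurable reward functions $R_\theta:\mathbb{R}^m\to\mathbb{R}$ which is a real vector space of finite dimension $d$. Let $D=\{(x_i,y_i,o_i)\}_{i=1}^n$ be a dataset of pairwise comparisons with $x_i,y_i\in\mathbb{R}^m$ and $o_i\in\{0,\tfrac12,1\}$ ($o_i=1$ if $y_i$ is preferred, $o_i=0$ if $x_i$ is preferred, $o_i=\tfrac12$ for indifference), and let the learner's loss be the Bradley–Terry negative log-likelihood $$\mathcal L(D;\theta)=\sum_i-\big[(1-o_i)\log \Pr\{x_i\succ y_i\mid R_\theta\}+o_i\log \Pr\{y_i\succ x_i\mid R_\theta\}\big],\qquad \Pr\{y\succ x\mid R\}=\frac{e^{R(y)}}{e^{R(x)}+e^{R(y)}} .$$ An attack $\delta\in\{-1,0,1\}^n$ with $\sum_i|\delta_i|\le B$ replaces $D$ by $\tilde D(\delta)=\{(x_i,y_i,o_i+\delta_i)\}_{i=1}^n$; let $\Omega$ be any set of such attacks (the attacks open to the adversary, for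 instance all those that keep every label in $\{0,\tfrac12,1\}$). Let $C^T\subset\mathbb{R}^m$ be a finite set of target outcomes. For outcomes $x_1,\dots,x_N$ put $$F(\theta)=\sum_{c\in C^T}\Pr_{x\sim\mathcal P}\{R_\theta(c)\ge R_\theta(x)\},\qquad \hat F(\theta)=\frac1N\sum_{c\in C^T}\sum_{i=1}^N\mathbf 1_{R_\theta(c)\ge R_\theta(x_i)},$$ and let $\mathrm{OPT}$ and $\widehat{\mathrm{OPT}}$ be the optima (suprema, with value $0$ if nothing is feasible) of $F(\theta)$ and $\hat F(\theta)$ in the bilevel problem of choosing $\delta\in\Omega$ and $\theta$ subject to $\theta\in\arg\min_{\theta'\in\Theta}\mathcal L(\tilde D(\delta);\theta')$. **Theorem.** For all $\varepsilon>0$ and $\gamma>0$, and all $$N>m_0(\varepsilon,\gamma)=\frac{64}{\varepsilon^2}\Big(2(d+1)\ln\frac{12}{\varepsilon}+\ln\frac4\gamma\Big),$$ if $x_1,\dots,x_N$ are drawn i.i.d. from $\mathcal P$, then with probability at least $1-\gamma$ $$\widehat{\mathrm{OPT}}\ \ge\ \mathrm{OPT}-|C^T|\,\varepsilon .$$ In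 particular, for a single target outcome, $\widehat{\mathrm{OPT}}\ge \mathrm{OPT}-\varepsilon$. -/

import Mathlib

open MeasureTheory

noncomputable section

/-- A pairwise comparison `(x, y, o)`: two outcomes and a preference label, where `o = 0` means that
`x` is preferred to `y`, `o = 1` that `y` is preferred to `x`, and `o = 1/2` indifference. -/
structure Comparison (X : Type*) where
  x : X
  y : X
  o : ℝ

/-- The Bradley-Terry probability `Pr{y ≻ x | R} = e^{R y} / (e^{R x} + e^{R y})`. -/
def bradleyTerry {X : Type*} (R : X → ℝ) (x y : X) : ℝ :=
  Real.exp (R y) / (Real.exp (R x) + Real.exp (R y))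

/-- The negative log-likelihood of a dataset under the Bradley-Terry model with reward `R`. -/
def btLoss {X : Type*} {n : ℕ} (D : Fin n → Comparison X) (R : X → ℝ) : ℝ :=
  ∑ i, -((1 - (D i).o) * Real.log (bradleyTerry R (D i).y (D i).x)
        + (D i).o * Real.log (bradleyTerry R (D i).x (D i).y))

/-- Label perturbations `δ ∈ {-1, 0, 1}ⁿ` within the budget `∑ |δ i| ≤ B`. -/
def budgetAttacks (n B : ℕ) : Set (Fin n → ℤ) :=
  {δ | (∀ i, δ i = -1 ∨ δ i = 0 ∨ δ i = 1) ∧ ∑ i, |δ i| ≤ (B : ℤ)}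

/-- The poisoned dataset, with labels `o i + δ i` and unchanged outcomes. -/
def poison {X : Type*} {n : ℕ} (D : Fin n → Comparison X) (δ : Fin n → ℤ) :
    Fin n → Comparison X :=
  fun i => { x := (D i).x, y := (D i).y, o := (D i).o + (δ i : ℝ) }

/-- The lower-level problem: the parameters that are maximum-likelihood estimates for `D`. -/
def learned {X Θ : Type*} {n : ℕ} (R : Θ → X → ℝ) (D : Fin n → Comparison X) : Set Θ :=
  {θ | ∀ θ' : Θ, btLoss D (R θ) ≤ btLoss D (R θ')}

/-- The promotion objective `∑_{c ∈ C} Pr_{x ∼ P}{r c ≥ r x}` of a reward function `r`. -/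
def trueObjective {X : Type*} [MeasurableSpace X] (P : Measure X) (C : Finset X)
    (r : X → ℝ) : ℝ :=
  ∑ c ∈ C, P.real {x | r c ≥ r x}

open Classical in
/-- The finite-sample promotion objective of a reward function `r`, normalized by `1 / N`. -/
def sampleObjective {X : Type*} {N : ℕ} (s : Fin N → X) (C : Finset X) (r : X → ℝ) : ℝ :=
  (1 / (N : ℝ)) * ∑ c ∈ C, ∑ i, if r c ≥ r (s i) then (1 : ℝ) else 0

/-- The optimum of the bilevel problem "maximize `G (R θ)` over attacks `δ ∈ Ω`, subject to `θ`
being learned from the dataset poisoned by `δ`". -/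
def bilevelOptimum {X Θ : Type*} {n : ℕ} (R : Θ → X → ℝ) (D : Fin n → Comparison X)
    (Ω : Set (Fin n → ℤ)) (G : (X → ℝ) → ℝ) : ℝ :=
  sSup {v | ∃ δ ∈ Ω, ∃ θ ∈ learned R (poison D δ), v = G (R θ)}

/-- The sample size `m₀(ε, γ) = (64 / ε²) (2 (d + 1) ln (12 / ε) + ln (4 / γ))`. -/
def sampleBound (d : ℕ) (ε γ : ℝ) : ℝ :=
  64 / ε ^ 2 * (2 * ((d : ℝ) + 1) * Real.log (12 / ε) + Real.log (4 / γ))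

end

/-! The bound is one-sided and the feasible pairs `(δ, θ)` do not depend on the sample, so no
uniform convergence over the reward family is needed. Fix, before sampling, a feasible pair whose
true objective is within `|C| ε / 2` of the optimum. The objective is the mean of `targetCount`,
which takes values in `[0, |C|]`, so Hoeffding for this single reward costs another `|C| ε / 2`
outside an event of probability at most `exp (-N ε² / 2) ≤ γ`. The same pair is feasible for the
sampled problem and bounds its optimum from below. -/

/-- **Hoeffding's inequality**, lower tail, for an i.i.d. sample drawn from a product measure. -/
lemma measureReal_pi_sum_le_integral_sub_le {X : Type*} [MeasurableSpace X] (P : Measure X)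
    [IsProbabilityMeasure P] {N : ℕ} {f : X → ℝ} (hf : Measurable f) {b t : ℝ} (hb : 0 < b)
    (hfb : ∀ x, f x ∈ Set.Icc 0 b) (ht : 0 ≤ t) :
    (Measure.pi (fun _ : Fin N => P)).real
      {s | ∑ i, f (s i) ≤ (N : ℝ) * (∫ x, f x ∂P) - (N : ℝ) * b * t} ≤
        Real.exp (-(2 * (N : ℝ) * t ^ 2)) := by
  rcases Nat.eq_zero_or_pos N with rfl | hN
  · simp
  have hN' : (0 : ℝ) < N := by exact_mod_cast hN
  -- The sign turns the lower tail into the upper tail of a centred sum.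
  set g : X → ℝ := fun x => -(f x - ∫ y, f y ∂P) with hg
  have hgm : Measurable g := (hf.sub_const _).neg
  have hsub : ProbabilityTheory.HasSubgaussianMGF g ((‖b - 0‖₊ / 2) ^ 2) P :=
    (ProbabilityTheory.hasSubgaussianMGF_of_mem_Icc hf.aemeasurable
      (Filter.Eventually.of_forall hfb)).neg
  have hsubi (i : Fin N) : ProbabilityTheory.HasSubgaussianMGF (fun s : Fin N → X => g (s i))
      ((‖b - 0‖₊ / 2) ^ 2) (Measure.pi (fun _ : Fin N => P)) := by
    refine ProbabilityTheory.HasSubgaussianMGF.of_map (X := g) (Y := fun s : Fin N → X => s i)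
      (measurable_pi_apply i).aemeasurable ?_
    rwa [(measurePreserving_eval (fun _ : Fin N => P) i).map_eq]
  have hind := ProbabilityTheory.iIndepFun_pi (μ := fun _ : Fin N => P)
    (X := fun _ => g) (fun _ => hgm.aemeasurable)
  have key := ProbabilityTheory.HasSubgaussianMGF.measure_sum_ge_le_of_iIndepFun hind
    (s := Finset.univ) (fun i _ => hsubi i) (ε := N * b * t) (by positivity)
  refine le_trans (le_of_eq ?_) (key.trans (le_of_eq ?_))
  · congr 1
    ext s
    simp only [hg, Set.mem_ofPred_eq, Finset.sum_neg_distrib, Finset.sum_sub_distrib,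
      Finset.sum_const, Finset.card_univ, Fintype.card_fin, nsmul_eq_mul]
    constructor <;> intro h <;> linarith
  -- Each term has variance proxy `(b / 2) ^ 2`, so the exponent is `(N b t)² / (2 N (b / 2)²) = 2 N
  -- t²`.
  · congr 1
    simp only [sub_zero, Finset.sum_const, Finset.card_univ, Fintype.card_fin, nsmul_eq_mul]
    push_cast
    rw [Real.norm_of_nonneg hb.le]
    field_simp

open Classical in
/-- The number of targets in `C` that are ranked at least as high as `x` by `r`. -/
noncomputable def targetCount {X : Type*} (C : Finset X) (r : X → ℝ) (x : X) : ℝ :=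
  ∑ c ∈ C, if r c ≥ r x then (1 : ℝ) else 0

lemma targetCount_mem_Icc {X : Type*} (C : Finset X) (r : X → ℝ) (x : X) :
    targetCount C r x ∈ Set.Icc 0 (C.card : ℝ) := by
  classical
  refine ⟨Finset.sum_nonneg fun c _ => by split_ifs <;> norm_num, ?_⟩
  calc targetCount C r x ≤ ∑ c ∈ C, (1 : ℝ) :=
        Finset.sum_le_sum fun c _ => by split_ifs <;> norm_num
    _ = C.card := by simp

lemma measurable_targetCount {X : Type*} [MeasurableSpace X] (C : Finset X) {r : X → ℝ}
    (hr : Measurable r) : Measurable (targetCount C r) :=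
  Finset.measurable_fun_sum _ fun _ _ =>
    Measurable.ite (measurableSet_le hr measurable_const) measurable_const measurable_const

lemma integral_targetCount {X : Type*} [MeasurableSpace X] (P : Measure X)
    [IsProbabilityMeasure P] (C : Finset X) {r : X → ℝ} (hr : Measurable r) :
    ∫ x, targetCount C r x ∂P = trueObjective P C r := by
  classical
  have hm (c : X) : MeasurableSet {x | r c ≥ r x} := measurableSet_le hr measurable_const
  have hi (c : X) : (fun x => if r c ≥ r x then (1 : ℝ) else 0) =
      {x | r c ≥ r x}.indicator 1 := by
    ext x
    simp [Set.indicator_apply]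
  have hint (c : X) : Integrable (fun x => if r c ≥ r x then (1 : ℝ) else 0) P := by
    rw [hi]
    exact (integrable_const (1 : ℝ)).indicator (hm c)
  unfold targetCount trueObjective
  rw [integral_finsetSum _ fun c _ => by convert hint c]
  refine Finset.sum_congr rfl fun c _ => ?_
  rw [← integral_indicator_one (hm c), ← hi]

lemma sampleObjective_eq_sum_targetCount {X : Type*} {N : ℕ} (s : Fin N → X) (C : Finset X)
    (r : X → ℝ) : sampleObjective s C r = (1 / (N : ℝ)) * ∑ i, targetCount C r (s i) := by
  unfold sampleObjective targetCount
  rw [Finset.sum_comm]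

lemma sampleObjective_nonneg {X : Type*} {N : ℕ} (s : Fin N → X) (C : Finset X) (r : X → ℝ) :
    0 ≤ sampleObjective s C r := by
  rw [sampleObjective_eq_sum_targetCount]
  exact mul_nonneg (by positivity)
    (Finset.sum_nonneg fun i _ => (targetCount_mem_Icc C r (s i)).1)

lemma sampleObjective_le_card {X : Type*} {N : ℕ} (s : Fin N → X) (C : Finset X) (r : X → ℝ) :
    sampleObjective s C r ≤ C.card := by
  rw [sampleObjective_eq_sum_targetCount]
  rcases Nat.eq_zero_or_pos N with rfl | hN
  · simp
  have hN' : (0 : ℝ) < N := by exact_mod_cast hN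
  rw [one_div, inv_mul_le_iff₀ hN']
  calc ∑ i, targetCount C r (s i) ≤ ∑ _i : Fin N, (C.card : ℝ) :=
        Finset.sum_le_sum fun i _ => (targetCount_mem_Icc C r (s i)).2
    _ = N * C.card := by simp

lemma measurable_sampleObjective {X : Type*} [MeasurableSpace X] {N : ℕ} (C : Finset X)
    {r : X → ℝ} (hr : Measurable r) :
    Measurable fun s : Fin N → X => sampleObjective s C r := by
  simp only [sampleObjective_eq_sum_targetCount]
  exact (Finset.measurable_fun_sum _ fun i _ =>
    (measurable_targetCount C hr).comp (measurable_pi_apply i)).const_mul _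

lemma trueObjective_le_card {X : Type*} [MeasurableSpace X] (P : Measure X)
    [IsProbabilityMeasure P] (C : Finset X) (r : X → ℝ) : trueObjective P C r ≤ C.card := by
  calc trueObjective P C r ≤ ∑ c ∈ C, (1 : ℝ) := Finset.sum_le_sum fun c _ => measureReal_le_one
    _ = C.card := by simp

/-- The sample objective of a fixed reward function is unlikely to fall far below the true one. -/
lemma measureReal_sampleObjective_le_trueObjective_sub_le {X : Type*} [MeasurableSpace X]
    (P : Measure X) [IsProbabilityMeasure P] {N : ℕ} (hN : 0 < N) {C : Finset X}
    (hC : C.Nonempty) {r : X → ℝ} (hr : Measurable r) {t : ℝ} (ht : 0 ≤ t) :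
    (Measure.pi (fun _ : Fin N => P)).real
      {s | sampleObjective s C r ≤ trueObjective P C r - C.card * t} ≤
        Real.exp (-(2 * (N : ℝ) * t ^ 2)) := by
  have hN' : (0 : ℝ) < N := by exact_mod_cast hN
  have hC' : (0 : ℝ) < C.card := by exact_mod_cast hC.card_pos
  convert measureReal_pi_sum_le_integral_sub_le P (N := N) (measurable_targetCount C hr) hC'
    (targetCount_mem_Icc C r) ht using 3
  ext s
  rw [integral_targetCount P C hr, sampleObjective_eq_sum_targetCount, one_div,
    inv_mul_le_iff₀ hN', mul_sub, mul_assoc]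

section bilevelOptimum

variable {X Θ : Type*} {n : ℕ} {R : Θ → X → ℝ} {D : Fin n → Comparison X}
  {Ω : Set (Fin n → ℤ)} {G : (X → ℝ) → ℝ}

lemma bilevelOptimum_nonneg (hG : ∀ r, 0 ≤ G r) : 0 ≤ bilevelOptimum R D Ω G := by
  refine Real.sSup_nonneg ?_
  rintro v ⟨δ, -, θ, -, rfl⟩
  exact hG _

lemma bilevelOptimum_le {b : ℝ} (hb : 0 ≤ b) (hG : ∀ r, G r ≤ b) :
    bilevelOptimum R D Ω G ≤ b := by
  refine Real.sSup_le ?_ hb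
  rintro v ⟨δ, -, θ, -, rfl⟩
  exact hG _

lemma le_bilevelOptimum {b : ℝ} (hG : ∀ r, G r ≤ b) {δ : Fin n → ℤ} (hδ : δ ∈ Ω) {θ : Θ}
    (hθ : θ ∈ learned R (poison D δ)) : G (R θ) ≤ bilevelOptimum R D Ω G := by
  refine le_csSup ⟨b, ?_⟩ ⟨δ, hδ, θ, hθ, rfl⟩
  rintro v ⟨δ, -, θ, -, rfl⟩
  exact hG _

/-- The supremum need not be attained, hence the slack `a`. Since `sSup ∅ = 0`, the condition `0 ≤
a` rules out an empty feasible set. -/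
lemma exists_learned_of_lt_bilevelOptimum {a : ℝ} (ha : 0 ≤ a)
    (h : a < bilevelOptimum R D Ω G) :
    ∃ δ ∈ Ω, ∃ θ ∈ learned R (poison D δ), a < G (R θ) := by
  by_contra! hle
  refine h.not_ge (Real.sSup_le ?_ ha)
  rintro v ⟨δ, hδ, θ, hθ, rfl⟩
  exact hle δ hδ θ hθ

end bilevelOptimum

/-- Hoeffding only needs `N ε² / 2 ≥ log (1 / γ)`. For `ε < 1` the dimension term is nonnegative and
can be dropped, leaving `N ε² > 64 log (1 / γ)`. -/
lemma exp_neg_le_of_sampleBound_lt {d N : ℕ} {ε γ : ℝ} (hε : 0 < ε) (hε1 : ε < 1) (hγ : 0 < γ)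
    (hγ1 : γ < 1) (hN : sampleBound d ε γ < (N : ℝ)) :
    0 < N ∧ Real.exp (-(2 * (N : ℝ) * (ε / 2) ^ 2)) ≤ γ := by
  have hlogγ : 0 < Real.log (1 / γ) := Real.log_pos ((one_lt_div hγ).2 hγ1)
  have hlog : Real.log (1 / γ) ≤ Real.log (4 / γ) := by
    apply Real.log_le_log (by positivity)
    gcongr
    norm_num
  have hlogε : 0 < Real.log (12 / ε) := Real.log_pos ((one_lt_div hε).2 (by linarith))
  have hbound : 64 / ε ^ 2 * Real.log (1 / γ) < N := by
    refine lt_of_le_of_lt ?_ hN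
    unfold sampleBound
    have : 0 ≤ 2 * ((d : ℝ) + 1) * Real.log (12 / ε) := by positivity
    gcongr
    linarith
  refine ⟨by exact_mod_cast (by positivity : 0 ≤ 64 / ε ^ 2 * Real.log (1 / γ)).trans_lt hbound, ?_⟩
  rw [← Real.le_log_iff_exp_le hγ]
  rw [div_mul_eq_mul_div, div_lt_iff₀ (by positivity)] at hbound
  rw [one_div, Real.log_inv] at hbound hlogγ
  nlinarith

theorem mainTheorem1 {m n d N B : ℕ} {Θ : Type*}
    (P : Measure (EuclideanSpace ℝ (Fin m))) [IsProbabilityMeasure P]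
    (R : Θ → EuclideanSpace ℝ (Fin m) → ℝ) (hR : ∀ θ, Measurable (R θ))
    (V : Submodule ℝ (EuclideanSpace ℝ (Fin m) → ℝ)) [FiniteDimensional ℝ V]
    (hV : Set.range R = (V : Set (EuclideanSpace ℝ (Fin m) → ℝ)))
    (hd : Module.finrank ℝ V = d)
    (D : Fin n → Comparison (EuclideanSpace ℝ (Fin m)))
    (hD : ∀ i, (D i).o = 0 ∨ (D i).o = 1 / 2 ∨ (D i).o = 1)
    (Ω : Set (Fin n → ℤ)) (hΩ : Ω ⊆ budgetAttacks n B)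
    (C : Finset (EuclideanSpace ℝ (Fin m)))
    (ε γ : ℝ) (hε : 0 < ε) (hγ : 0 < γ) (hN : sampleBound d ε γ < (N : ℝ)) :
    ∃ E : Set (Fin N → EuclideanSpace ℝ (Fin m)), MeasurableSet E ∧
      1 - γ ≤ (Measure.pi (fun _ : Fin N => P)).real E ∧
      ∀ s ∈ E, bilevelOptimum R D Ω (sampleObjective s C) ≥
        bilevelOptimum R D Ω (trueObjective P C) - (C.card : ℝ) * ε := by
  by_cases hγ1 : 1 ≤ γ
  · exact ⟨∅, MeasurableSet.empty, by simpa using hγ1, by simp⟩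
  push Not at hγ1
  have hnonneg (s : Fin N → EuclideanSpace ℝ (Fin m)) :
      0 ≤ bilevelOptimum R D Ω (sampleObjective s C) :=
    bilevelOptimum_nonneg fun r => sampleObjective_nonneg s C r
  -- If the optimum is at most `|C| ε`, nonnegativity suffices. Otherwise, as it is at most `|C|`,
  -- both `C.Nonempty` and `ε < 1` follow.
  by_cases hsmall : bilevelOptimum R D Ω (trueObjective P C) ≤ C.card * ε
  · refine ⟨Set.univ, MeasurableSet.univ, by simpa using hγ.le, fun s _ => ?_⟩
    linarith [hnonneg s]
  push Not at hsmall
  have hle : bilevelOptimum R D Ω (trueObjective P C) ≤ C.card :=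
    bilevelOptimum_le (by positivity) (trueObjective_le_card P C)
  have hC' : (0 : ℝ) < C.card := (by positivity : 0 ≤ (C.card : ℝ) * ε).trans_lt (hsmall.trans_le hle)
  have hC : C.Nonempty := Finset.card_pos.1 (by exact_mod_cast hC')
  have hε1 : ε < 1 := by nlinarith
  obtain ⟨hNpos, hexp⟩ := exp_neg_le_of_sampleBound_lt hε hε1 hγ hγ1 hN
  have hCε : 0 < (C.card : ℝ) * ε := by positivity
  obtain ⟨δ, hδ, θ, hθ, hlt⟩ := exists_learned_of_lt_bilevelOptimum
    (sub_nonneg.2 ((by linarith : (C.card : ℝ) * (ε / 2) ≤ C.card * ε).trans hsmall.le))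
    (sub_lt_self (bilevelOptimum R D Ω (trueObjective P C)) (by positivity))
  have hmeas : MeasurableSet {s : Fin N → EuclideanSpace ℝ (Fin m) |
      sampleObjective s C (R θ) ≤ trueObjective P C (R θ) - C.card * (ε / 2)} :=
    measurableSet_le (measurable_sampleObjective C (hR θ)) measurable_const
  refine ⟨_, hmeas.compl, ?_, fun s hs => ?_⟩
  · rw [probReal_compl_eq_one_sub hmeas]
    linarith [measureReal_sampleObjective_le_trueObjective_sub_le P hNpos hC (hR θ)
      (half_pos hε).le]
  · simp only [Set.mem_compl_iff, Set.mem_ofPred_eq, not_le] at hs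
    have := le_bilevelOptimum (G := sampleObjective s C) (sampleObjective_le_card s C) hδ hθ
    linarith
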